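/- Let $(V,\omega)$ be a $2n$-dimensional real symplectic space, i.e. a real vector space of dimension $2n$ with a skew-symmetric non-degenerate bilinear form $\omega$. Notation. A subspace $W\subseteq V$ is *symplectic* if $W\cap W^{\perp_s}=\{0\}$, where $W^{\perp_s}=\{v\in V:\omega(v,w)=0\ \forall w\in W\}$. A *symplectic basis* is a basis $\{p_1,q_1,\dots,p_n,q_n\}$ of $V$ with $\omega(p_i,p_j)=\omega(q_i,q_j)=0$ and $\omega(p_i,q_j)=\delta_{ij}$. A quadratic form $Q$ on $V$ with symmetric bilinear form $\Phi_Q(u,v)=\frac12\bigl(Q(u+v)-Q(u)-Q(v)\bigr)$ is positive semi-definite if $Q(u)=\Phi_Q(u,u)\ge 0$ for all $u$; its *Hamilton map* is the unique linear map $H_Q:V\to V$ with $\Phi_Q(u,v)=\omega(u,H_Q v)$ for all $u,v\in V$. The *Poisson bracket* of smooth functions $f,g:V\to\mathbb R$ is $$\{f,g\}(u)=\sum_{i=1}^n\left(\frac{\partial f(u)}{\partial p_i}\frac{\partial g(u)}{\partial q_i}-\frac{\partial f(u)}{\partial q_i}\frac{\partial g(u)}{\partial p_i}\right),$$ where $\{p_1,q_1,\dots,p_n,q_n\}$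 is a fixed symplectic basis of $V$ (the bracket does not depend on which one). A quadratic form $Q$ *reduces to a symplectic normal form* in a symplectic basis if, after listing the pairs $(p_i,q_i)$ of that basis in a suitable order (which may depend on $Q$), there are integers $k,\ell\ge 0$ with $k+\ell\le n$ and numbers $\mu_1,\dots,\mu_k>0$ such that for all $(x_1,y_1,\dots,x_n,y_n)\in\mathbb R^{2n}$ $$Q\Bigl(\sum_{i=1}^n(x_ip_i+y_iq_i)\Bigr)=\sum_{i=1}^k\mu_i(x_i^2+y_i^2)+\sum_{i=k+1}^{k+\ell}x_i^2 .$$ Theorem. (a) Let $Q,R$ be positive semi-definite quadratic forms on $V$ such that $\ker(H_Q)$ and $\ker(H_R)$ are symplectic subspaces. Then there exists a symplectic basis of $V$ in which both $Q$ and $R$ reduce to symplectic normal forms if and only if $\ker(H_Q)\cap\ker(H_R)$ is a symplectic subspace and $\{Q,R\}=0$ identically on $V$. (b) Let $\mathcal F$ be a non-empty family of positive semi-definite quadratic forms on $V$ such that $\ker(H_Q)$ is a symplectic subspace for every $Q\in\mathcal F$. Then there exists a common symplectic basis of $V$ in which every $Q\in\mathcal F$ reduces to a symplectic normal form if and only if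 $\bigcap_{Q\in\mathcal F}\ker(H_Q)$ is a symplectic subspace and $\{Q,R\}=0$ identically on $V$ for all $Q,R\in\mathcal F$. -/

import Mathlib

open Module

noncomputable section

namespace SymplecticNormalForm

variable {V : Type*} [AddCommGroup V] [Module ℝ V]

/-- A symplectic form on a real vector space: a skew-symmetric, non-degenerate bilinear form. -/
structure IsSymplecticForm (ω : LinearMap.BilinForm ℝ V) : Prop where
  skew : ∀ u v, ω u v = -ω v u
  nondegenerate : ω.Nondegenerate

/-- A subspace `W` is symplectic if it meets its symplectic orthogonal complement only in zero. -/
def IsSymplecticSubspace (ω : LinearMap.BilinForm ℝ V) (W : Submodule ℝ V) : Prop :=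
  W ⊓ ω.orthogonal W = ⊥

/-- A basis `p₁, …, pₙ, q₁, …, qₙ` (with `p i = b (Sum.inl i)` and `q i = b (Sum.inr i)`) is a
symplectic basis. -/
structure IsSymplecticBasis (ω : LinearMap.BilinForm ℝ V) {n : ℕ}
    (b : Basis (Fin n ⊕ Fin n) ℝ V) : Prop where
  pp : ∀ i j, ω (b (Sum.inl i)) (b (Sum.inl j)) = 0
  qq : ∀ i j, ω (b (Sum.inr i)) (b (Sum.inr j)) = 0
  pq : ∀ i j, ω (b (Sum.inl i)) (b (Sum.inr j)) = if i = j then 1 else 0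

/-- Positive semi-definiteness of a quadratic form. The associated symmetric bilinear form `Φ`
satisfies `Φ u u = Q u`. -/
def IsPosSemidef (Q : QuadraticForm ℝ V) : Prop :=
  ∀ u, 0 ≤ Q u

/-! ### Existence of symplectic bases -/

theorem IsSymplecticForm.self_eq_zero {ω : LinearMap.BilinForm ℝ V} (hω : IsSymplecticForm ω)
    (u : V) : ω u u = 0 := by
  have := hω.skew u u
  linarith

/-- A symplectic family `p, q` spans a subspace on which its coordinates are given by `ω`. -/
theorem linearIndependent_of_symplectic {ω : LinearMap.BilinForm ℝ V} (hω : IsSymplecticForm ω)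
    {n : ℕ} {p q : Fin n → V} (hpp : ∀ i j, ω (p i) (p j) = 0) (hqq : ∀ i j, ω (q i) (q j) = 0)
    (hpq : ∀ i j, ω (p i) (q j) = if i = j then 1 else 0) :
    LinearIndependent ℝ (Sum.elim p q) := by
  have hqp : ∀ i j, ω (q i) (p j) = if i = j then -1 else 0 := by
    intro i j
    rw [hω.skew, hpq]
    by_cases h : i = j <;> simp [h, eq_comm]
  rw [Fintype.linearIndependent_iff]
  intro g hg i
  simp only [Fintype.sum_sum_type, Sum.elim_inl, Sum.elim_inr] at hg
  rcases i with i | i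
  · have := congrArg (fun v => ω v (q i)) hg
    simpa [hqq, hpq] using this
  · have := congrArg (fun v => ω v (p i)) hg
    simpa [hpp, hqp] using this

theorem exists_symplecticBasis [FiniteDimensional ℝ V] {ω : LinearMap.BilinForm ℝ V}
    (hω : IsSymplecticForm ω) :
    ∃ (n : ℕ) (b : Basis (Fin n ⊕ Fin n) ℝ V), IsSymplecticBasis ω b := by
  classical
  let P : ℕ → Prop := fun n => ∃ p q : Fin n → V, (∀ i j, ω (p i) (p j) = 0) ∧
    (∀ i j, ω (q i) (q j) = 0) ∧ (∀ i j, ω (p i) (q j) = if i = j then 1 else 0)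
  have hP0 : P 0 := ⟨Fin.elim0, Fin.elim0, fun i => i.elim0, fun i => i.elim0, fun i => i.elim0⟩
  have hbound : ∀ n, P n → n ≤ finrank ℝ V := by
    rintro n ⟨p, q, h1, h2, h3⟩
    have := (linearIndependent_of_symplectic hω h1 h2 h3).fintype_card_le_finrank
    simp at this
    omega
  obtain ⟨n, ⟨p, q, h1, h2, h3⟩, hmax⟩ : ∃ n, P n ∧ ¬ P (n + 1) := by
    by_contra! hcon
    have hall : ∀ n, P n := fun n => Nat.rec hP0 (fun k ih => hcon k ih) n
    have := hbound _ (hall (finrank ℝ V + 1))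
    omega
  have h4 : ∀ i j, ω (q i) (p j) = if i = j then -1 else 0 := by
    intro i j
    rw [hω.skew, h3]
    by_cases h : i = j <;> simp [h, eq_comm]
  -- the component of a vector that is orthogonal to the family
  let r : V → V := fun v => v - ∑ i, (ω v (q i) • p i - ω v (p i) • q i)
  have hrp : ∀ v j, ω (r v) (p j) = 0 := by
    intro v j
    simp [r, h1, h4, Finset.sum_sub_distrib]
  have hrq : ∀ v j, ω (r v) (q j) = 0 := by
    intro v j
    simp [r, h2, h3, Finset.sum_sub_distrib]
  have hr0 : ∀ v, r v = 0 := by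
    intro v
    by_contra hne
    obtain ⟨w, hw⟩ : ∃ w, ω (r v) w ≠ 0 := by
      by_contra! hall
      exact hne (hω.nondegenerate.1 _ hall)
    have hw' : ω (r v) (r w) = ω (r v) w := by
      have hz : ω (r v) (∑ i, (ω w (q i) • p i - ω w (p i) • q i)) = 0 := by
        rw [map_sum]
        refine Finset.sum_eq_zero fun i _ => ?_
        rw [map_sub, map_smul, map_smul, hrp, hrq, smul_zero, smul_zero, sub_zero]
      change ω (r v) (w - ∑ i, (ω w (q i) • p i - ω w (p i) • q i)) = ω (r v) w
      rw [map_sub (ω (r v)), hz, sub_zero]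
    have hf : ω (r v) ((ω (r v) w)⁻¹ • r w) = 1 := by
      rw [map_smul, hw', smul_eq_mul, inv_mul_cancel₀ hw]
    have hfp : ∀ j, ω ((ω (r v) w)⁻¹ • r w) (p j) = 0 := by
      intro j; rw [map_smul, LinearMap.smul_apply, hrp, smul_zero]
    have hfq : ∀ j, ω ((ω (r v) w)⁻¹ • r w) (q j) = 0 := by
      intro j; rw [map_smul, LinearMap.smul_apply, hrq, smul_zero]
    generalize (ω (r v) w)⁻¹ • r w = f at hf hfp hfq
    apply hmax
    refine ⟨Fin.cons (r v) p, Fin.cons f q, ?_, ?_, ?_⟩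
    · intro i j
      refine Fin.cases ?_ (fun i => ?_) i <;> refine Fin.cases ?_ (fun j => ?_) j
      · exact hω.self_eq_zero _
      · exact hrp v j
      · simp only [Fin.cons_zero, Fin.cons_succ]
        rw [hω.skew, hrp, neg_zero]
      · exact h1 i j
    · intro i j
      refine Fin.cases ?_ (fun i => ?_) i <;> refine Fin.cases ?_ (fun j => ?_) j
      · exact hω.self_eq_zero _
      · exact hfq j
      · simp only [Fin.cons_zero, Fin.cons_succ]
        rw [hω.skew, hfq, neg_zero]
      · exact h2 i j
    · intro i j
      refine Fin.cases ?_ (fun i => ?_) i <;> refine Fin.cases ?_ (fun j => ?_) j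
      · simpa using hf
      · simpa [Fin.succ_ne_zero, eq_comm] using hrq v j
      · simp only [Fin.cons_zero, Fin.cons_succ]
        rw [hω.skew, hfp]
        simp [Fin.succ_ne_zero]
      · simpa using h3 i j
  have hspan : ⊤ ≤ Submodule.span ℝ (Set.range (Sum.elim p q)) := by
    intro v _
    rw [sub_eq_zero.mp (hr0 v)]
    refine Submodule.sum_mem _ fun i _ => Submodule.sub_mem _ ?_ ?_
    · exact Submodule.smul_mem _ _ (Submodule.subset_span ⟨Sum.inl i, rfl⟩)
    · exact Submodule.smul_mem _ _ (Submodule.subset_span ⟨Sum.inr i, rfl⟩)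
  refine ⟨n, Basis.mk (linearIndependent_of_symplectic hω h1 h2 h3) hspan, ?_, ?_, ?_⟩
  · simpa using h1
  · simpa using h2
  · simpa using h3

/-! ### The Poisson bracket -/

/-- The Poisson bracket of `f` and `g` computed in the coordinates `(x, y)` of a basis `p, q`.
The partial derivative of `f` at `u` with respect to the coordinate `xᵢ` (respectively `yᵢ`) is the
derivative of `f` at `u` along the line through `u` in the direction `p i` (respectively `q i`). -/
def poissonBracketIn {n : ℕ} (b : Basis (Fin n ⊕ Fin n) ℝ V) (f g : V → ℝ) : V → ℝ := fun u =>
  ∑ i, (lineDeriv ℝ f u (b (Sum.inl i)) * lineDeriv ℝ g u (b (Sum.inr i)) -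
    lineDeriv ℝ f u (b (Sum.inr i)) * lineDeriv ℝ g u (b (Sum.inl i)))

/-- The Poisson bracket on a symplectic space: it is computed in a fixed symplectic basis. By
`poissonBracket_eq` below the choice of the symplectic basis does not matter for quadratic forms. -/
def poissonBracket [FiniteDimensional ℝ V] {ω : LinearMap.BilinForm ℝ V} (hω : IsSymplecticForm ω)
    (f g : V → ℝ) : V → ℝ :=
  poissonBracketIn (exists_symplecticBasis hω).choose_spec.choose f g

/-! ### The Hamilton map -/

/-- The Hamilton map of `Q`: the linear map `H` with `Φ u v = ω u (H v)`, where `Φ` is the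
symmetric bilinear form `Φ u v = (Q (u + v) - Q u - Q v) / 2` of `Q`. -/
def hamiltonMap [FiniteDimensional ℝ V] {ω : LinearMap.BilinForm ℝ V} (hω : IsSymplecticForm ω)
    (Q : QuadraticForm ℝ V) : V →ₗ[ℝ] V :=
  (LinearMap.BilinForm.toDual ω.flip hω.nondegenerate.flip).symm.toLinearMap ∘ₗ
    QuadraticMap.associated Q

theorem apply_hamiltonMap [FiniteDimensional ℝ V] {ω : LinearMap.BilinForm ℝ V}
    (hω : IsSymplecticForm ω) (Q : QuadraticForm ℝ V) (u v : V) :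
    ω u (hamiltonMap hω Q v) = (Q (u + v) - Q u - Q v) / 2 := by
  have h : ω.flip (hamiltonMap hω Q v) u = QuadraticMap.associated Q v u :=
    LinearMap.BilinForm.apply_toDual_symm_apply (hB := hω.nondegenerate.flip) _ _
  rw [LinearMap.BilinForm.flip_apply] at h
  rw [h, QuadraticMap.associated_apply, add_comm v u]
  simp
  ring

theorem eq_hamiltonMap [FiniteDimensional ℝ V] {ω : LinearMap.BilinForm ℝ V}
    (hω : IsSymplecticForm ω) (Q : QuadraticForm ℝ V) (H : V →ₗ[ℝ] V)
    (hH : ∀ u v, ω u (H v) = (Q (u + v) - Q u - Q v) / 2) : H = hamiltonMap hω Q := by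
  ext v
  refine sub_eq_zero.mp (hω.nondegenerate.2 _ fun u => ?_)
  rw [map_sub, hH, apply_hamiltonMap, sub_self]

/-! ### The Poisson bracket of quadratic forms does not depend on the symplectic basis -/

theorem lineDeriv_quadraticForm [FiniteDimensional ℝ V] {ω : LinearMap.BilinForm ℝ V}
    (hω : IsSymplecticForm ω) (Q : QuadraticForm ℝ V) (u v : V) :
    lineDeriv ℝ Q u v = 2 * ω v (hamiltonMap hω Q u) := by
  have h : ∀ t : ℝ, Q (u + t • v) = Q u + t * (2 * ω v (hamiltonMap hω Q u)) + t * t * Q v := by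
    intro t
    have h1 := apply_hamiltonMap hω Q (t • v) u
    rw [map_smul, LinearMap.smul_apply, smul_eq_mul, QuadraticMap.map_smul, add_comm (t • v) u,
      smul_eq_mul] at h1
    linarith
  rw [lineDeriv]
  simp only [h]
  have hd : HasDerivAt (fun t : ℝ => Q u + t * (2 * ω v (hamiltonMap hω Q u)) + t * t * Q v)
      (1 * (2 * ω v (hamiltonMap hω Q u)) + (1 * 0 + 0 * 1) * Q v) 0 :=
    (((hasDerivAt_id (0 : ℝ)).mul_const _).const_add _).add
      (((hasDerivAt_id (0 : ℝ)).mul (hasDerivAt_id (0 : ℝ))).mul_const _)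
  rw [hd.deriv]
  ring

theorem poissonBracketIn_quadraticForm [FiniteDimensional ℝ V] {ω : LinearMap.BilinForm ℝ V}
    (hω : IsSymplecticForm ω) {n : ℕ} {b : Basis (Fin n ⊕ Fin n) ℝ V}
    (hb : IsSymplecticBasis ω b) (Q R : QuadraticForm ℝ V) (u : V) :
    poissonBracketIn b Q R u = 4 * ω (hamiltonMap hω Q u) (hamiltonMap hω R u) := by
  have hqp : ∀ i j, ω (b (Sum.inr i)) (b (Sum.inl j)) = if i = j then -1 else 0 := by
    intro i j
    rw [hω.skew, hb.pq]
    by_cases h : i = j <;> simp [h, eq_comm]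
  have key : ∀ X Y : V, ∑ i, (ω (b (Sum.inl i)) X * ω (b (Sum.inr i)) Y -
      ω (b (Sum.inr i)) X * ω (b (Sum.inl i)) Y) = ω X Y := by
    intro X Y
    have hX := b.sum_repr X
    simp only [Fintype.sum_sum_type] at hX
    rw [← hX]
    simp [hb.pp, hb.qq, hb.pq, hqp, Finset.sum_add_distrib, add_comm]
  rw [← key, Finset.mul_sum]
  refine Finset.sum_congr rfl fun i _ => ?_
  simp only [lineDeriv_quadraticForm hω]
  ring

theorem poissonBracket_eq [FiniteDimensional ℝ V] {ω : LinearMap.BilinForm ℝ V}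
    (hω : IsSymplecticForm ω) {n : ℕ} {b : Basis (Fin n ⊕ Fin n) ℝ V}
    (hb : IsSymplecticBasis ω b) (Q R : QuadraticForm ℝ V) :
    poissonBracket hω Q R = poissonBracketIn b Q R := by
  funext u
  rw [poissonBracketIn_quadraticForm hω hb, poissonBracket,
    poissonBracketIn_quadraticForm hω (exists_symplecticBasis hω).choose_spec.choose_spec]

/-! ### Symplectic normal forms -/

/-- The displayed symplectic normal form in the basis `p, q`, for the given order of the pairs
`(p i, q i)`: with positive `μ₁, …, μₖ` and `k + l ≤ n`,
`Q (∑ (xᵢ pᵢ + yᵢ qᵢ)) = ∑_{i ≤ k} μᵢ (xᵢ² + yᵢ²) + ∑_{k < i ≤ k + l} xᵢ²`.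
Indices start at zero in the code. -/
def HasOrderedNormalForm {n : ℕ} (b : Basis (Fin n ⊕ Fin n) ℝ V) (Q : QuadraticForm ℝ V) : Prop :=
  ∃ (k l : ℕ) (μ : Fin n → ℝ), k + l ≤ n ∧ (∀ i : Fin n, (i : ℕ) < k → 0 < μ i) ∧
    ∀ x y : Fin n → ℝ,
      Q (∑ i, (x i • b (Sum.inl i) + y i • b (Sum.inr i))) =
        ∑ i with (i : Fin n).val < k, μ i * (x i ^ 2 + y i ^ 2) +
          ∑ i with k ≤ (i : Fin n).val ∧ (i : Fin n).val < k + l, x i ^ 2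

/-- `Q` reduces to a symplectic normal form in the symplectic basis `{p₁, q₁, …, pₙ, qₙ}`: it has
the displayed shape after the pairs `(p i, q i)` are listed in a suitable order. -/
def ReducesToNormalForm {n : ℕ} (b : Basis (Fin n ⊕ Fin n) ℝ V) (Q : QuadraticForm ℝ V) : Prop :=
  ∃ σ : Equiv.Perm (Fin n), HasOrderedNormalForm (b.reindex (Equiv.sumCongr σ σ)) Q

end SymplecticNormalForm

end

/-!
Vanishing of the bracket `{Q, R}` says `ω (H_Q u) (H_R u) = 0` for all `u`, and since Hamilton maps
are skew for `ω` this means that `H_Q` and `H_R` commute (`poissonBracket_eq_zero_iff`). For a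
positive semi-definite form whose Hamilton map has a symplectic kernel, a normal form cannot contain
an isolated square, so a symplectic basis reduces `Q` to normal form exactly when `H_Q` acts by
`p i ↦ μ i q i`, `q i ↦ -μ i p i` (`isDiagonalIn_of_reducesToNormalForm`,
`reducesToNormalForm_of_isDiagonalIn`). The theorem thus asks when a family of Hamilton maps can
simultaneously be brought to this shape.

If it can, the maps commute and their common kernel is spanned by pairs `p i, q i`, so it is
symplectic. Conversely, some finite sum `A` of the commuting maps has the common kernel of the
family as its kernel (`exists_mem_closure_ker_le`), because the isotropic vectors of a positive
semi-definite form are its radical. As this kernel meets its orthogonal trivially, `ω u (A u)` is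
positive definite on the range of `A`, and there the maps `A ∘ H` are symmetric and commute. A
common eigenvector `e` then spans, together with `A e`, a plane on which every `H` is a multiple of
one rotation (`exists_eigenplane_of_invariant`). The orthogonal of finitely many such planes is
invariant, and either it lies in the common kernel, where any conjugate pair will do, or the
argument applies inside it (`IsEigenplaneFamily.exists_succ`); so the planes can be added one by one
until they fill the space.

The statement for two forms is the statement for the family `{Q, R}`.
-/

namespace SymplecticNormalForm

section

variable {V : Type*} [AddCommGroup V] [Module ℝ V] {ω : LinearMap.BilinForm ℝ V}

/-! ### Positive Hamilton maps -/

/-- `H` is the Hamilton map of a positive semi-definite quadratic form, namely of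
`u ↦ ω u (H u)`. -/
structure IsPosHamiltonian (ω : LinearMap.BilinForm ℝ V) (H : V →ₗ[ℝ] V) : Prop where
  symm : ∀ u v, ω u (H v) = ω v (H u)
  nonneg : ∀ u, 0 ≤ ω u (H u)

namespace IsPosHamiltonian

theorem zero : IsPosHamiltonian ω 0 := ⟨by simp, by simp⟩

theorem add {H K : V →ₗ[ℝ] V} (hH : IsPosHamiltonian ω H) (hK : IsPosHamiltonian ω K) :
    IsPosHamiltonian ω (H + K) := by
  refine ⟨fun u v => ?_, fun u => ?_⟩
  · simp [hH.symm u v, hK.symm u v]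
  · simpa using add_nonneg (hH.nonneg u) (hK.nonneg u)

/-- Hamilton maps are skew with respect to the symplectic form. -/
theorem apply_left {H : V →ₗ[ℝ] V} (hH : IsPosHamiltonian ω H) (hω : IsSymplecticForm ω)
    (u v : V) : ω (H u) v = -ω u (H v) := by
  rw [hω.skew, hH.symm]

/-- The isotropic vectors of a positive semi-definite form lie in its radical. -/
theorem apply_eq_zero {H : V →ₗ[ℝ] V} (hH : IsPosHamiltonian ω H) (hω : IsSymplecticForm ω)
    {u : V} (hu : ω u (H u) = 0) : H u = 0 := by
  refine hω.nondegenerate.2 _ fun v => ?_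
  have hc := hH.nonneg v
  have hquad : ∀ t : ℝ, 0 ≤ 2 * t * ω v (H u) + t ^ 2 * ω v (H v) := by
    intro t
    have h := hH.nonneg (u + t • v)
    simp only [map_add, map_smul, LinearMap.add_apply, LinearMap.smul_apply, smul_eq_mul, hu,
      hH.symm u v] at h
    linarith
  generalize ω v (H v) = c at *
  generalize ω v (H u) = b at *
  by_contra hb
  have h := hquad (-b / (c + 1))
  have hc1 : 0 < c + 1 := by linarith
  have heq : 2 * (-b / (c + 1)) * b + (-b / (c + 1)) ^ 2 * c =
      -(b ^ 2 * (c + 2) / (c + 1) ^ 2) := by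
    field_simp
    ring
  rw [heq] at h
  have : 0 < b ^ 2 * (c + 2) / (c + 1) ^ 2 := by positivity
  linarith

theorem ker_add {H K : V →ₗ[ℝ] V} (hH : IsPosHamiltonian ω H) (hK : IsPosHamiltonian ω K)
    (hω : IsSymplecticForm ω) :
    LinearMap.ker (H + K) = LinearMap.ker H ⊓ LinearMap.ker K := by
  ext u
  simp only [LinearMap.mem_ker, Submodule.mem_inf, LinearMap.add_apply]
  refine ⟨fun h => ?_, fun h => by rw [h.1, h.2, add_zero]⟩
  have hsum : ω u (H u) + ω u (K u) = 0 := by rw [← map_add, h, map_zero]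
  have h1 := hH.nonneg u
  have h2 := hK.nonneg u
  exact ⟨hH.apply_eq_zero hω (by linarith), hK.apply_eq_zero hω (by linarith)⟩

end IsPosHamiltonian

/-! ### Simultaneous eigenvectors -/

/-- An endomorphism that is symmetric for a positive definite form has a real eigenvector. -/
theorem exists_eigenvector_of_posDef {E : Type*} [AddCommGroup E] [Module ℝ E]
    [FiniteDimensional ℝ E] [Nontrivial E] (B : LinearMap.BilinForm ℝ E)
    (hsymm : ∀ u v, B u v = B v u) (hpos : ∀ u, u ≠ 0 → 0 < B u u)
    (T : E →ₗ[ℝ] E) (hT : ∀ u v, B (T u) v = B u (T v)) :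
    ∃ (c : ℝ) (v : E), v ≠ 0 ∧ T v = c • v := by
  let core : InnerProductSpace.Core ℝ E :=
    { inner := fun u v => B u v
      conj_inner_symm := fun u v => by simpa using hsymm v u
      re_inner_nonneg := fun u => by
        rcases eq_or_ne u 0 with rfl | hu
        · simp
        · simpa using (hpos u hu).le
      add_left := fun u v w => by simp
      smul_left := fun u v r => by simp
      definite := fun u hu => by
        by_contra hne
        exact (hpos u hne).ne' hu }
  let _ : NormedAddCommGroup E := core.toNormedAddCommGroup
  let _ : InnerProductSpace ℝ E := InnerProductSpace.ofCore core.toCore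
  have hTs : T.IsSymmetric := fun u v => hT u v
  obtain ⟨v, hv⟩ := (hTs.hasEigenvalue_iSup_of_finiteDimensional).exists_hasEigenvector
  exact ⟨_, v, hv.2, hv.apply_eq_smul⟩

/-- Commuting maps that are symmetric for a form which is positive definite on a non-zero common
invariant subspace `N` have a common eigenvector in `N`: on a minimal invariant subspace each of
them is a scalar. -/
theorem exists_common_eigenvector [FiniteDimensional ℝ V] (B : LinearMap.BilinForm ℝ V)
    (hsymm : ∀ u v, B u v = B v u) (S : Set (V →ₗ[ℝ] V))
    (hS : ∀ T ∈ S, ∀ u v, B (T u) v = B u (T v))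
    (hcomm : ∀ T ∈ S, ∀ T' ∈ S, ∀ u, T (T' u) = T' (T u))
    (N : Submodule ℝ V) (hN : N ≠ ⊥) (hpos : ∀ u ∈ N, u ≠ 0 → 0 < B u u)
    (hinv : ∀ T ∈ S, ∀ u ∈ N, T u ∈ N) :
    ∃ e ∈ N, e ≠ 0 ∧ ∀ T ∈ S, ∃ c : ℝ, T e = c • e := by
  let 𝓜 : Set (Submodule ℝ V) := {M | M ≠ ⊥ ∧ M ≤ N ∧ ∀ T ∈ S, ∀ u ∈ M, T u ∈ M}
  obtain ⟨M, ⟨hM0, hMN, hMinv⟩, hmin⟩ :=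
    WellFounded.has_min (wellFounded_lt (α := Submodule ℝ V)) 𝓜 ⟨N, hN, le_rfl, hinv⟩
  obtain ⟨e, heM, he0⟩ := (Submodule.ne_bot_iff M).mp hM0
  refine ⟨e, hMN heM, he0, fun T hT => ?_⟩
  have : Nontrivial M := Submodule.nontrivial_iff_ne_bot.mpr hM0
  obtain ⟨c, v, hv0, hv⟩ := exists_eigenvector_of_posDef (B.restrict M)
    (fun u v => by simpa using hsymm u v)
    (fun u hu => by simpa using hpos u (hMN u.2) (by simpa using hu))
    (T.restrict (hMinv T hT)) (fun u v => by simpa using hS T hT u v)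
  refine ⟨c, ?_⟩
  -- the eigenspace of `T` in `M` is again invariant, hence all of `M`
  have hE : M ⊓ LinearMap.ker (T - c • LinearMap.id) ∈ 𝓜 := by
    refine ⟨(Submodule.ne_bot_iff _).mpr ⟨v, ⟨v.2, ?_⟩, by simpa using hv0⟩,
      inf_le_left.trans hMN, fun T' hT' u hu => ⟨hMinv T' hT' u hu.1, ?_⟩⟩
    · have := congrArg Subtype.val hv
      simpa [sub_eq_zero] using this
    · have := hu.2
      simp only [SetLike.mem_coe, LinearMap.mem_ker, LinearMap.sub_apply, LinearMap.smul_apply,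
        LinearMap.id_apply, sub_eq_zero] at this ⊢
      rw [hcomm T hT T' hT', this, map_smul]
  have hle : M ≤ M ⊓ LinearMap.ker (T - c • LinearMap.id) := by
    by_contra hnot
    exact hmin _ hE (lt_of_le_not_ge inf_le_left hnot)
  have := (hle heM).2
  simpa [sub_eq_zero] using this

/-! ### Extending a symplectic family of eigenplanes -/

/-- A symplectic family `p, q` such that each `H ∈ 𝓗` maps the plane of `p i, q i` to itself as a
multiple of the rotation `p i ↦ q i`, `q i ↦ -p i`. -/
structure IsEigenplaneFamily (ω : LinearMap.BilinForm ℝ V) (𝓗 : Set (V →ₗ[ℝ] V)) {m : ℕ}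
    (p q : Fin m → V) : Prop where
  pp : ∀ i j, ω (p i) (p j) = 0
  qq : ∀ i j, ω (q i) (q j) = 0
  pq : ∀ i j, ω (p i) (q j) = if i = j then 1 else 0
  eigen : ∀ H ∈ 𝓗, ∀ i, ∃ μ : ℝ, H (p i) = μ • q i ∧ H (q i) = -(μ • p i)

theorem IsEigenplaneFamily.cons {𝓗 : Set (V →ₗ[ℝ] V)} {m : ℕ} {p q : Fin m → V}
    (h : IsEigenplaneFamily ω 𝓗 p q) (hω : IsSymplecticForm ω) {e f : V} (hef : ω e f = 1)
    (hpe : ∀ i, ω (p i) e = 0) (hqe : ∀ i, ω (q i) e = 0)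
    (hpf : ∀ i, ω (p i) f = 0) (hqf : ∀ i, ω (q i) f = 0)
    (heigen : ∀ H ∈ 𝓗, ∃ μ : ℝ, H e = μ • f ∧ H f = -(μ • e)) :
    IsEigenplaneFamily ω 𝓗 (Fin.cons e p : Fin (m + 1) → V) (Fin.cons f q : Fin (m + 1) → V) := by
  have hep : ∀ i, ω e (p i) = 0 := fun i => by rw [hω.skew, hpe, neg_zero]
  have heq : ∀ i, ω e (q i) = 0 := fun i => by rw [hω.skew, hqe, neg_zero]
  have hfq : ∀ i, ω f (q i) = 0 := fun i => by rw [hω.skew, hqf, neg_zero]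
  refine ⟨?_, ?_, ?_, ?_⟩
  · intro i j
    refine Fin.cases ?_ (fun i => ?_) i <;> refine Fin.cases ?_ (fun j => ?_) j
    · exact hω.self_eq_zero _
    · exact hep j
    · exact hpe i
    · exact h.pp i j
  · intro i j
    refine Fin.cases ?_ (fun i => ?_) i <;> refine Fin.cases ?_ (fun j => ?_) j
    · exact hω.self_eq_zero _
    · exact hfq j
    · exact hqf i
    · exact h.qq i j
  · intro i j
    refine Fin.cases ?_ (fun i => ?_) i <;> refine Fin.cases ?_ (fun j => ?_) j
    · simpa using hef
    · simpa [(Fin.succ_ne_zero _).symm] using heq j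
    · simpa [Fin.succ_ne_zero] using hpf i
    · simpa using h.pq i j
  · intro H hH i
    refine Fin.cases ?_ (fun i => ?_) i
    · exact heigen H hH
    · exact h.eigen H hH i

/-- Every non-zero vector orthogonal to a symplectic family has a conjugate vector that is also
orthogonal to the family. -/
theorem IsEigenplaneFamily.exists_conjugate {𝓗 : Set (V →ₗ[ℝ] V)} {m : ℕ} {p q : Fin m → V}
    (h : IsEigenplaneFamily ω 𝓗 p q) (hω : IsSymplecticForm ω) {e : V} (he : e ≠ 0)
    (hpe : ∀ i, ω (p i) e = 0) (hqe : ∀ i, ω (q i) e = 0) :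
    ∃ f, ω e f = 1 ∧ (∀ i, ω (p i) f = 0) ∧ ∀ i, ω (q i) f = 0 := by
  obtain ⟨w, hw⟩ : ∃ w, ω e w ≠ 0 := by
    by_contra! hall
    exact he (hω.nondegenerate.1 _ hall)
  have hqp : ∀ i j, ω (q i) (p j) = if i = j then -1 else 0 := by
    intro i j
    rw [hω.skew, h.pq]
    by_cases hij : i = j <;> simp [hij, eq_comm]
  have hep : ∀ i, ω e (p i) = 0 := fun i => by rw [hω.skew, hpe, neg_zero]
  have heq : ∀ i, ω e (q i) = 0 := fun i => by rw [hω.skew, hqe, neg_zero]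
  refine ⟨(ω e w)⁻¹ • (w - ∑ i, (ω (p i) w • q i - ω (q i) w • p i)), ?_, fun j => ?_, fun j => ?_⟩
  · simp [hep, heq, inv_mul_cancel₀ hw]
  · simp [h.pp, h.pq]
  · simp [h.qq, hqp]

/-- If `A² = -a²` on `e` and every `H` maps `e` into the line of `A e`, then suitable multiples of
`e` and `A e` span a plane on which every `H` is a multiple of one rotation. -/
theorem exists_eigenplane {𝓗 : Set (V →ₗ[ℝ] V)} {A : V →ₗ[ℝ] V}
    (hcomm : ∀ H ∈ 𝓗, ∀ u, A (H u) = H (A u)) {e : V} (he : 0 < ω e (A e)) {a : ℝ} (ha : 0 < a)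
    (hAA : A (A e) = -(a ^ 2 • e)) (heig : ∀ H ∈ 𝓗, ∃ m : ℝ, H e = m • A e) :
    ∃ s t : ℝ, ω (s • e) (t • A e) = 1 ∧
      ∀ H ∈ 𝓗, ∃ μ : ℝ, H (s • e) = μ • (t • A e) ∧ H (t • A e) = -(μ • (s • e)) := by
  -- `s = t a` makes `H` take the same value on both vectors, and `t² a ω(e, A e) = 1`
  -- normalizes their pairing
  obtain ⟨t, ht⟩ : ∃ t : ℝ, t * t = (a * ω e (A e))⁻¹ :=
    ⟨√((a * ω e (A e))⁻¹), Real.mul_self_sqrt (by positivity)⟩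
  refine ⟨t * a, t, ?_, fun H hH => ?_⟩
  · simp only [map_smul, LinearMap.smul_apply, smul_eq_mul]
    have : a * ω e (A e) ≠ 0 := by positivity
    calc t * (t * a * ω e (A e)) = t * t * (a * ω e (A e)) := by ring
      _ = 1 := by rw [ht, inv_mul_cancel₀ this]
  · obtain ⟨m, hm⟩ := heig H hH
    refine ⟨a * m, ?_, ?_⟩
    · rw [map_smul, hm, smul_smul, smul_smul]
      congr 1
      ring
    · rw [map_smul, ← hcomm H hH, hm, map_smul, hAA, smul_smul, smul_neg, smul_smul, smul_smul]
      congr 2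
      ring

/-- A common eigenplane inside a subspace `U` which is invariant under the commuting family and not
contained in the kernel of `A`. The form `u ↦ ω u (A u)` is positive definite on the range of `A`,
so the maps `A ∘ H` have a common eigenvector in `A U`. -/
theorem exists_eigenplane_of_invariant [FiniteDimensional ℝ V] (hω : IsSymplecticForm ω)
    {𝓗 : Set (V →ₗ[ℝ] V)} (h𝓗 : ∀ H ∈ 𝓗, IsPosHamiltonian ω H)
    (hcomm : ∀ H ∈ 𝓗, ∀ K ∈ 𝓗, ∀ u, H (K u) = K (H u)) {A : V →ₗ[ℝ] V} (hA𝓗 : A ∈ 𝓗)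
    (hker : ∀ H ∈ 𝓗, LinearMap.ker A ≤ LinearMap.ker H)
    (hsymp : IsSymplecticSubspace ω (LinearMap.ker A)) {U : Submodule ℝ V}
    (hU : ∀ H ∈ 𝓗, ∀ u ∈ U, H u ∈ U) (hUA : ¬ U ≤ LinearMap.ker A) :
    ∃ e f, e ∈ U ∧ f ∈ U ∧ ω e f = 1 ∧ ∀ H ∈ 𝓗, ∃ μ : ℝ, H e = μ • f ∧ H f = -(μ • e) := by
  have hA := h𝓗 A hA𝓗
  have hperp : ∀ H ∈ 𝓗, ∀ u, H u ∈ ω.orthogonal (LinearMap.ker A) := by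
    intro H hH u w hw
    change ω w (H u) = 0
    rw [(h𝓗 H hH).symm, LinearMap.mem_ker.mp (hker H hH hw), map_zero]
  have hzero : ∀ u, A u = 0 → u ∈ ω.orthogonal (LinearMap.ker A) → u = 0 := by
    intro u hu hu'
    have hmem : u ∈ LinearMap.ker A ⊓ ω.orthogonal (LinearMap.ker A) := ⟨hu, hu'⟩
    rw [hsymp] at hmem
    simpa using hmem
  have hpos : ∀ u, A u ≠ 0 → 0 < ω (A u) (A (A u)) := by
    intro u hu
    refine lt_of_le_of_ne (hA.nonneg _) fun h => hu ?_
    exact hzero _ (hA.apply_eq_zero hω h.symm) (hperp A hA𝓗 u)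
  obtain ⟨e, heN, he0, heig⟩ := exists_common_eigenvector (ω.compRight A)
    (fun u v => by simpa using hA.symm u v) ((fun H => A ∘ₗ H) '' 𝓗)
    (by
      rintro _ ⟨H, hH, rfl⟩ u v
      simp only [LinearMap.BilinForm.compRight_apply, LinearMap.comp_apply]
      rw [hA.apply_left hω, (h𝓗 H hH).apply_left hω, neg_neg, hcomm H hH A hA𝓗,
        hcomm H hH A hA𝓗])
    (by
      rintro _ ⟨H, hH, rfl⟩ _ ⟨K, hK, rfl⟩ u
      simp only [LinearMap.comp_apply]
      rw [← hcomm A hA𝓗 H hH, ← hcomm A hA𝓗 K hK, hcomm H hH K hK])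
    (U.map A)
    (fun h => hUA (LinearMap.le_ker_iff_map.mpr h))
    (by
      rintro _ ⟨u, -, rfl⟩ hu
      exact hpos u hu)
    (by
      rintro _ ⟨H, hH, rfl⟩ _ ⟨u, hu, rfl⟩
      exact ⟨H (A u), hU H hH _ (hU A hA𝓗 u hu), rfl⟩)
  obtain ⟨w, hw, rfl⟩ := heN
  have hd := hpos w he0
  have hAAw : A (A w) ≠ 0 := fun h => by simp [h] at hd
  obtain ⟨c, hc⟩ := heig _ ⟨A, hA𝓗, rfl⟩
  rw [LinearMap.comp_apply] at hc
  have hc0 : c < 0 := by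
    have h := hpos (A w) hAAw
    rw [hc, map_smul, smul_eq_mul, hω.skew] at h
    by_contra! hcon
    nlinarith
  have hlin : ∀ H ∈ 𝓗, ∃ m : ℝ, H (A w) = m • A (A w) := by
    intro H hH
    obtain ⟨d, hd⟩ := heig _ ⟨H, hH, rfl⟩
    rw [LinearMap.comp_apply] at hd
    refine ⟨d / c, sub_eq_zero.mp (hzero _ ?_ ?_)⟩
    · rw [map_sub, map_smul, hc, hd, smul_smul, div_mul_cancel₀ _ hc0.ne, sub_self]
    · exact Submodule.sub_mem _ (hperp H hH _) (Submodule.smul_mem _ _ (hperp A hA𝓗 _))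
  obtain ⟨s, t, hst, hmaps⟩ := exists_eigenplane (𝓗 := 𝓗)
    (fun H hH => hcomm A hA𝓗 H hH) hd (a := √(-c)) (Real.sqrt_pos.mpr (by linarith))
    (by rw [hc, Real.sq_sqrt (by linarith), neg_smul, neg_neg]) hlin
  exact ⟨s • A w, t • A (A w), U.smul_mem _ (hU A hA𝓗 w hw),
    U.smul_mem _ (hU A hA𝓗 _ (hU A hA𝓗 w hw)), hst, hmaps⟩

/-- A family of eigenplanes that does not fill the space can be extended by one plane. -/
theorem IsEigenplaneFamily.exists_succ [FiniteDimensional ℝ V] (hω : IsSymplecticForm ω)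
    {𝓗 : Set (V →ₗ[ℝ] V)} (h𝓗 : ∀ H ∈ 𝓗, IsPosHamiltonian ω H)
    (hcomm : ∀ H ∈ 𝓗, ∀ K ∈ 𝓗, ∀ u, H (K u) = K (H u)) {A : V →ₗ[ℝ] V} (hA𝓗 : A ∈ 𝓗)
    (hker : ∀ H ∈ 𝓗, LinearMap.ker A ≤ LinearMap.ker H)
    (hsymp : IsSymplecticSubspace ω (LinearMap.ker A)) {m : ℕ} {p q : Fin m → V}
    (h : IsEigenplaneFamily ω 𝓗 p q) (hm : 2 * m < finrank ℝ V) :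
    ∃ p' q' : Fin (m + 1) → V, IsEigenplaneFamily ω 𝓗 p' q' := by
  let φ : V →ₗ[ℝ] (Fin m ⊕ Fin m → ℝ) := LinearMap.pi fun i => ω (Sum.elim p q i)
  have hmem : ∀ u, u ∈ LinearMap.ker φ ↔ (∀ i, ω (p i) u = 0) ∧ ∀ i, ω (q i) u = 0 := by
    intro u
    rw [LinearMap.mem_ker, funext_iff]
    simp [φ]
  have hU : ∀ H ∈ 𝓗, ∀ u ∈ LinearMap.ker φ, H u ∈ LinearMap.ker φ := by
    intro H hH u hu
    rw [hmem] at hu ⊢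
    constructor <;> intro i <;> obtain ⟨μ, h1, h2⟩ := h.eigen H hH i
    · rw [(h𝓗 H hH).symm, h1, map_smul, hω.skew, hu.2]
      simp
    · rw [(h𝓗 H hH).symm, h2, map_neg, map_smul, hω.skew, hu.1]
      simp
  by_cases hUA : LinearMap.ker φ ≤ LinearMap.ker A
  · have hne : LinearMap.ker φ ≠ ⊥ := LinearMap.ker_ne_bot_of_finrank_lt (by simp; omega)
    obtain ⟨e, he, he0⟩ := (Submodule.ne_bot_iff _).mp hne
    obtain ⟨hpe, hqe⟩ := (hmem e).mp he
    obtain ⟨f, hef, hpf, hqf⟩ := h.exists_conjugate hω he0 hpe hqe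
    refine ⟨_, _, h.cons hω hef hpe hqe hpf hqf fun H hH => ⟨0, ?_⟩⟩
    have h1 : H e = 0 := hker H hH (hUA he)
    have h2 : H f = 0 := hker H hH (hUA ((hmem f).mpr ⟨hpf, hqf⟩))
    simp [h1, h2]
  · obtain ⟨e, f, he, hf, hef, heig⟩ :=
      exists_eigenplane_of_invariant hω h𝓗 hcomm hA𝓗 hker hsymp hU hUA
    rw [hmem] at he hf
    exact ⟨_, _, h.cons hω hef he.1 he.2 hf.1 hf.2 heig⟩

/-! ### Simultaneous diagonalization -/

/-- Some finite sum of members of a family of positive Hamilton maps has the smallest possible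
kernel, namely the common kernel of the family. -/
theorem exists_mem_closure_ker_le [FiniteDimensional ℝ V] (hω : IsSymplecticForm ω)
    {𝓗 : Set (V →ₗ[ℝ] V)} (h𝓗 : ∀ H ∈ AddSubmonoid.closure 𝓗, IsPosHamiltonian ω H) :
    ∃ A ∈ AddSubmonoid.closure 𝓗, ∀ H ∈ AddSubmonoid.closure 𝓗,
      LinearMap.ker A ≤ LinearMap.ker H := by
  obtain ⟨_, ⟨A, hA, rfl⟩, hmin⟩ :=
    WellFounded.has_min (wellFounded_lt (α := Submodule ℝ V))
      (LinearMap.ker '' (AddSubmonoid.closure 𝓗 : Set (V →ₗ[ℝ] V))) ⟨_, 0, zero_mem _, rfl⟩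
  refine ⟨A, hA, fun H hH => ?_⟩
  have hsum := (h𝓗 A hA).ker_add (h𝓗 H hH) hω
  by_contra hnot
  refine hmin _ ⟨A + H, add_mem hA hH, rfl⟩ ?_
  rw [hsum]
  exact lt_of_le_not_ge inf_le_left fun hle => hnot (hle.trans inf_le_right)

/-- `H` acts by `p i ↦ μ i • q i`, `q i ↦ -(μ i • p i)` on the basis `p, q`. If the basis is
symplectic, this is the Hamilton map of `∑ μ i (x i ^ 2 + y i ^ 2)`. -/
def IsDiagonalIn {n : ℕ} (b : Basis (Fin n ⊕ Fin n) ℝ V) (H : V →ₗ[ℝ] V) (μ : Fin n → ℝ) : Prop :=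
  ∀ i, H (b (Sum.inl i)) = μ i • b (Sum.inr i) ∧ H (b (Sum.inr i)) = -(μ i • b (Sum.inl i))

/-- Commuting positive Hamilton maps with symplectic common kernel are diagonal in a common
symplectic basis. -/
theorem exists_symplecticBasis_isDiagonalIn [FiniteDimensional ℝ V] (hω : IsSymplecticForm ω)
    {n : ℕ} (hn : finrank ℝ V = 2 * n) {𝓗 : Set (V →ₗ[ℝ] V)}
    (h𝓗 : ∀ H ∈ 𝓗, IsPosHamiltonian ω H)
    (hcomm : ∀ H ∈ 𝓗, ∀ K ∈ 𝓗, ∀ u, H (K u) = K (H u))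
    (hsymp : IsSymplecticSubspace ω (⨅ H ∈ 𝓗, LinearMap.ker H)) :
    ∃ b : Basis (Fin n ⊕ Fin n) ℝ V, IsSymplecticBasis ω b ∧
      ∀ H ∈ 𝓗, ∃ μ, IsDiagonalIn b H μ := by
  have hpos : ∀ H ∈ AddSubmonoid.closure 𝓗, IsPosHamiltonian ω H := fun H hH => by
    induction hH using AddSubmonoid.closure_induction with
    | mem H hH => exact h𝓗 H hH
    | zero => exact .zero
    | add H K _ _ ihH ihK => exact ihH.add ihK
  have hcommC : ∀ H ∈ AddSubmonoid.closure 𝓗, ∀ K ∈ AddSubmonoid.closure 𝓗,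
      ∀ u, H (K u) = K (H u) := by
    intro H hH K hK
    induction hH, hK using AddSubmonoid.closure_induction₂ with
    | mem H K hH hK => exact hcomm H hH K hK
    | zero_left K _ => simp
    | zero_right H _ => simp
    | add_left H H' K _ _ _ h1 h2 => intro u; simp [h1 u, h2 u]
    | add_right H K K' _ _ _ h1 h2 => intro u; simp [h1 u, h2 u]
  obtain ⟨A, hA, hker⟩ := exists_mem_closure_ker_le hω hpos
  have hkerA : LinearMap.ker A = ⨅ H ∈ 𝓗, LinearMap.ker H := by
    refine le_antisymm (le_iInf₂ fun H hH => hker H (AddSubmonoid.subset_closure hH)) ?_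
    intro u hu
    simp only [Submodule.mem_iInf, LinearMap.mem_ker] at hu ⊢
    clear hker
    induction hA using AddSubmonoid.closure_induction with
    | mem H hH => exact hu H hH
    | zero => rfl
    | add H K _ _ ihH ihK => rw [LinearMap.add_apply, ihH, ihK, add_zero]
  rw [← hkerA] at hsymp
  have hex : ∀ m ≤ n, ∃ p q : Fin m → V,
      IsEigenplaneFamily ω (AddSubmonoid.closure 𝓗 : Set (V →ₗ[ℝ] V)) p q := by
    intro m
    induction m with
    | zero =>
      exact fun _ => ⟨Fin.elim0, Fin.elim0, fun i => i.elim0, fun i => i.elim0, fun i => i.elim0,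
        fun _ _ i => i.elim0⟩
    | succ m ih =>
      intro hm
      obtain ⟨p, q, h⟩ := ih (by omega)
      exact h.exists_succ hω hpos hcommC hA hker hsymp (by omega)
  obtain ⟨p, q, h⟩ := hex n le_rfl
  have hli := linearIndependent_of_symplectic hω h.pp h.qq h.pq
  refine ⟨basisOfLinearIndependentOfCardEqFinrank' _ hli (by simp [hn, two_mul]),
    ⟨by simpa using h.pp, by simpa using h.qq, by simpa using h.pq⟩, fun H hH => ?_⟩
  choose μ hμ using h.eigen H (AddSubmonoid.subset_closure hH)
  exact ⟨μ, by simpa [IsDiagonalIn] using hμ⟩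

/-! ### Normal forms with symplectic kernel -/

theorem IsSymplecticBasis.qp {n : ℕ} {b : Basis (Fin n ⊕ Fin n) ℝ V} (hb : IsSymplecticBasis ω b)
    (hω : IsSymplecticForm ω) (i j : Fin n) :
    ω (b (Sum.inr i)) (b (Sum.inl j)) = if i = j then -1 else 0 := by
  rw [hω.skew, hb.pq]
  by_cases h : i = j <;> simp [h, eq_comm]

theorem IsSymplecticBasis.reindex {n : ℕ} {b : Basis (Fin n ⊕ Fin n) ℝ V}
    (hb : IsSymplecticBasis ω b) (σ : Equiv.Perm (Fin n)) :
    IsSymplecticBasis ω (b.reindex (Equiv.sumCongr σ σ)) := by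
  refine ⟨fun i j => ?_, fun i j => ?_, fun i j => ?_⟩
  · simpa using hb.pp _ _
  · simpa using hb.qq _ _
  · simpa using hb.pq (σ.symm i) (σ.symm j)

theorem exists_coordinates {n : ℕ} (b : Basis (Fin n ⊕ Fin n) ℝ V) (u : V) :
    ∃ x y : Fin n → ℝ, u = ∑ i, (x i • b (Sum.inl i) + y i • b (Sum.inr i)) := by
  refine ⟨fun i => b.repr u (Sum.inl i), fun i => b.repr u (Sum.inr i), ?_⟩
  have h := b.sum_repr u
  rw [Fintype.sum_sum_type] at h
  rw [Finset.sum_add_distrib, h]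

/-- The symplectic form in the coordinates of a symplectic basis. -/
theorem IsSymplecticBasis.apply_sum {n : ℕ} {b : Basis (Fin n ⊕ Fin n) ℝ V}
    (hb : IsSymplecticBasis ω b) (hω : IsSymplecticForm ω) (x y z w : Fin n → ℝ) :
    ω (∑ i, (x i • b (Sum.inl i) + y i • b (Sum.inr i)))
      (∑ i, (z i • b (Sum.inl i) + w i • b (Sum.inr i))) = ∑ i, (x i * w i - y i * z i) := by
  simp only [map_sum, map_add, map_smul, LinearMap.sum_apply, LinearMap.add_apply,
    LinearMap.smul_apply, hb.pp, hb.qq, hb.pq, hb.qp hω, smul_eq_mul]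
  simp [Finset.sum_add_distrib, mul_comm, sub_eq_add_neg, add_comm]

/-- The common kernel of diagonal maps is spanned by pairs `p i, q i`, hence symplectic. -/
theorem isSymplecticSubspace_iInf_ker_of_isDiagonalIn (hω : IsSymplecticForm ω) {n : ℕ}
    {b : Basis (Fin n ⊕ Fin n) ℝ V} (hb : IsSymplecticBasis ω b) {𝓗 : Set (V →ₗ[ℝ] V)}
    (h : ∀ H ∈ 𝓗, ∃ μ, IsDiagonalIn b H μ) :
    IsSymplecticSubspace ω (⨅ H ∈ 𝓗, LinearMap.ker H) := by
  refine (Submodule.eq_bot_iff _).mpr ?_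
  rintro v ⟨hv, hv'⟩
  obtain ⟨x, y, rfl⟩ := exists_coordinates b v
  refine Finset.sum_eq_zero fun i _ => ?_
  by_cases hi : ∀ H ∈ 𝓗, H (b (Sum.inl i)) = 0 ∧ H (b (Sum.inr i)) = 0
  · have h1 := hv' (b (Sum.inl i)) (by
      simp only [Submodule.mem_iInf, LinearMap.mem_ker]
      exact fun H hH => (hi H hH).1)
    have h2 := hv' (b (Sum.inr i)) (by
      simp only [Submodule.mem_iInf, LinearMap.mem_ker]
      exact fun H hH => (hi H hH).2)
    simp [hb.pp, hb.pq] at h1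
    simp [hb.qq, hb.qp hω] at h2
    rw [h1, h2, zero_smul, zero_smul, add_zero]
  · push Not at hi
    obtain ⟨H, hH, hne⟩ := hi
    obtain ⟨μ, hμ⟩ := h H hH
    have hμi : μ i ≠ 0 := by
      intro h0
      refine hne ?_ ?_ <;> simp [hμ i, h0]
    have hHv : H (∑ j, (x j • b (Sum.inl j) + y j • b (Sum.inr j))) = 0 := by
      simp only [SetLike.mem_coe, Submodule.mem_iInf, LinearMap.mem_ker] at hv
      exact hv H hH
    have hHv' : ∑ j, ((-(μ j * y j)) • b (Sum.inl j) + (μ j * x j) • b (Sum.inr j)) = 0 := by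
      rw [← hHv, map_sum]
      refine Finset.sum_congr rfl fun j _ => ?_
      rw [map_add, map_smul, map_smul, (hμ j).1, (hμ j).2]
      module
    have h1 := congrArg (ω (b (Sum.inl i))) hHv'
    have h2 := congrArg (ω (b (Sum.inr i))) hHv'
    simp [hb.pp, hb.pq, hμi] at h1
    simp [hb.qq, hb.qp hω, hμi] at h2
    rw [h1, h2, zero_smul, zero_smul, add_zero]

theorem IsDiagonalIn.comm {n : ℕ} {b : Basis (Fin n ⊕ Fin n) ℝ V} {H K : V →ₗ[ℝ] V}
    {μ ν : Fin n → ℝ} (hH : IsDiagonalIn b H μ) (hK : IsDiagonalIn b K ν) (u : V) :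
    H (K u) = K (H u) := by
  have : H ∘ₗ K = K ∘ₗ H := by
    refine b.ext ?_
    rintro (i | i) <;> simp [hH i, hK i, smul_smul, mul_comm]
  exact LinearMap.congr_fun this u

variable [FiniteDimensional ℝ V]

theorem isPosHamiltonian_hamiltonMap (hω : IsSymplecticForm ω) {Q : QuadraticForm ℝ V}
    (hQ : IsPosSemidef Q) : IsPosHamiltonian ω (hamiltonMap hω Q) := by
  refine ⟨fun u v => ?_, fun u => ?_⟩
  · rw [apply_hamiltonMap, apply_hamiltonMap, add_comm u v]
    ring
  · rw [apply_hamiltonMap, ← two_smul ℝ u, QuadraticMap.map_smul, smul_eq_mul]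
    linarith [hQ u]

theorem apply_hamiltonMap_self (hω : IsSymplecticForm ω) (Q : QuadraticForm ℝ V) (u : V) :
    ω u (hamiltonMap hω Q u) = Q u := by
  rw [apply_hamiltonMap, ← two_smul ℝ u, QuadraticMap.map_smul, smul_eq_mul]
  ring

/-- The Hamilton map of a quadratic form that is diagonal in a symplectic basis. -/
theorem hamiltonMap_of_diagonal (hω : IsSymplecticForm ω) {n : ℕ}
    {b : Basis (Fin n ⊕ Fin n) ℝ V} (hb : IsSymplecticBasis ω b) {Q : QuadraticForm ℝ V}
    {α β : Fin n → ℝ}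
    (hQ : ∀ x y : Fin n → ℝ, Q (∑ i, (x i • b (Sum.inl i) + y i • b (Sum.inr i))) =
      ∑ i, (α i * x i ^ 2 + β i * y i ^ 2)) (i : Fin n) :
    hamiltonMap hω Q (b (Sum.inl i)) = α i • b (Sum.inr i) ∧
      hamiltonMap hω Q (b (Sum.inr i)) = -(β i • b (Sum.inl i)) := by
  let H : V →ₗ[ℝ] V := b.constr ℝ
    (Sum.elim (fun i => α i • b (Sum.inr i)) fun i => -(β i • b (Sum.inl i)))
  have hl : ∀ i, H (b (Sum.inl i)) = α i • b (Sum.inr i) := fun i => by simp [H]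
  have hr : ∀ i, H (b (Sum.inr i)) = -(β i • b (Sum.inl i)) := fun i => by simp [H]
  have hH : H = hamiltonMap hω Q := by
    refine eq_hamiltonMap hω Q H fun u v => ?_
    obtain ⟨x, y, rfl⟩ := exists_coordinates b u
    obtain ⟨z, w, rfl⟩ := exists_coordinates b v
    have hHv : H (∑ i, (z i • b (Sum.inl i) + w i • b (Sum.inr i))) =
        ∑ i, ((-(β i * w i)) • b (Sum.inl i) + (α i * z i) • b (Sum.inr i)) := by
      rw [map_sum]
      refine Finset.sum_congr rfl fun i _ => ?_
      rw [map_add, map_smul, map_smul, hl, hr]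
      module
    have hadd : ∑ i, (x i • b (Sum.inl i) + y i • b (Sum.inr i)) +
        ∑ i, (z i • b (Sum.inl i) + w i • b (Sum.inr i)) =
        ∑ i, ((x i + z i) • b (Sum.inl i) + (y i + w i) • b (Sum.inr i)) := by
      rw [← Finset.sum_add_distrib]
      refine Finset.sum_congr rfl fun i _ => ?_
      module
    rw [hHv, hb.apply_sum hω, hadd, hQ, hQ, hQ, ← Finset.sum_sub_distrib,
      ← Finset.sum_sub_distrib, Finset.sum_div]
    refine Finset.sum_congr rfl fun i _ => ?_
    ring
  rw [← hH]
  exact ⟨hl i, hr i⟩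

/-- A normal form whose Hamilton map has a symplectic kernel contains no isolated squares `x i ^ 2`:
the corresponding `q i` would lie in the kernel and be orthogonal to it. -/
theorem isDiagonalIn_of_reducesToNormalForm (hω : IsSymplecticForm ω) {n : ℕ}
    {b : Basis (Fin n ⊕ Fin n) ℝ V} (hb : IsSymplecticBasis ω b) {Q : QuadraticForm ℝ V}
    (hQ : IsPosSemidef Q) (hsymp : IsSymplecticSubspace ω (LinearMap.ker (hamiltonMap hω Q)))
    (h : ReducesToNormalForm b Q) : ∃ μ, IsDiagonalIn b (hamiltonMap hω Q) μ := by
  obtain ⟨σ, k, l, μ, -, -, hform⟩ := h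
  have hb' := hb.reindex σ
  have hdiag := hamiltonMap_of_diagonal hω hb' (Q := Q)
    (α := fun i => if (i : ℕ) < k then μ i else if (i : ℕ) < k + l then 1 else 0)
    (β := fun i => if (i : ℕ) < k then μ i else 0) (by
      intro x y
      rw [hform, Finset.sum_filter, Finset.sum_filter, ← Finset.sum_add_distrib]
      refine Finset.sum_congr rfl fun i _ => ?_
      by_cases h1 : (i : ℕ) < k
      · simp [h1, not_le.mpr h1, mul_add]
      · by_cases h2 : (i : ℕ) < k + l <;> simp [h1, h2, not_lt.mp h1])
  refine ⟨fun i => if (σ i : ℕ) < k then μ (σ i) else 0, fun i => ?_⟩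
  obtain ⟨h1, h2⟩ := hdiag (σ i)
  simp only [Basis.reindex_apply, Equiv.sumCongr_symm, Equiv.sumCongr_apply, Sum.map_inl,
    Sum.map_inr, Equiv.symm_apply_apply] at h1 h2
  refine ⟨?_, h2⟩
  rw [h1]
  by_cases hk : (σ i : ℕ) < k
  · simp [hk]
  by_cases hl : (σ i : ℕ) < k + l
  · exfalso
    simp only [hk, hl, if_false, if_true, one_smul, zero_smul, neg_zero] at h1 h2
    have hmem : b (Sum.inr i) ∈ LinearMap.ker (hamiltonMap hω Q) ⊓
        ω.orthogonal (LinearMap.ker (hamiltonMap hω Q)) := by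
      refine ⟨h2, fun v hv => ?_⟩
      change ω v (b (Sum.inr i)) = 0
      rw [← h1, (isPosHamiltonian_hamiltonMap hω hQ).symm,
        LinearMap.mem_ker.mp hv, map_zero]
    rw [hsymp] at hmem
    exact b.ne_zero _ (by simpa using hmem)
  · simp [hk, hl]

/-- A permutation that lists the indices satisfying `P` first. -/
theorem exists_perm_lt_card_iff {n : ℕ} (P : Fin n → Prop) :
    ∃ (k : ℕ) (σ : Equiv.Perm (Fin n)), k ≤ n ∧ ∀ i, (σ i : ℕ) < k ↔ P i := by
  classical
  have hk : Fintype.card {i // P i} ≤ n := by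
    simpa using Fintype.card_subtype_le P
  have hcard : Fintype.card {i // P i} =
      Fintype.card {j : Fin n // (j : ℕ) < Fintype.card {i // P i}} := by
    generalize Fintype.card {i // P i} = k at hk ⊢
    rw [Fintype.card_subtype, Fin.card_filter_val_lt, min_eq_right hk]
  let e := Fintype.equivOfCardEq hcard
  refine ⟨Fintype.card {i // P i}, e.extendSubtype, hk, fun i => ⟨fun h => ?_, fun h => ?_⟩⟩
  · by_contra hP
    exact e.extendSubtype_not_mem i hP h
  · exact e.extendSubtype_mem i h

theorem reducesToNormalForm_of_isDiagonalIn (hω : IsSymplecticForm ω) {n : ℕ}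
    {b : Basis (Fin n ⊕ Fin n) ℝ V} (hb : IsSymplecticBasis ω b) {Q : QuadraticForm ℝ V}
    (hQ : IsPosSemidef Q) {μ : Fin n → ℝ} (h : IsDiagonalIn b (hamiltonMap hω Q) μ) :
    ReducesToNormalForm b Q := by
  have hμ : ∀ i, 0 ≤ μ i := by
    intro i
    have h0 := hQ (b (Sum.inl i))
    rw [← apply_hamiltonMap_self hω, (h i).1, map_smul, hb.pq, if_pos rfl, smul_eq_mul,
      mul_one] at h0
    exact h0
  have hform : ∀ x y : Fin n → ℝ, Q (∑ i, (x i • b (Sum.inl i) + y i • b (Sum.inr i))) =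
      ∑ i, μ i * (x i ^ 2 + y i ^ 2) := by
    intro x y
    have hHu : hamiltonMap hω Q (∑ i, (x i • b (Sum.inl i) + y i • b (Sum.inr i))) =
        ∑ i, ((-(μ i * y i)) • b (Sum.inl i) + (μ i * x i) • b (Sum.inr i)) := by
      rw [map_sum]
      refine Finset.sum_congr rfl fun i _ => ?_
      rw [map_add, map_smul, map_smul, (h i).1, (h i).2]
      module
    rw [← apply_hamiltonMap_self hω, hHu, hb.apply_sum hω]
    refine Finset.sum_congr rfl fun i _ => ?_
    ring
  obtain ⟨k, σ, hk, hσ⟩ := exists_perm_lt_card_iff fun i => 0 < μ i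
  refine ⟨σ, k, 0, fun i => μ (σ.symm i), by simpa using hk, fun i hi => ?_, fun x y => ?_⟩
  · rw [← hσ]
    simpa using hi
  · have hsum : ∑ i, (x i • (b.reindex (Equiv.sumCongr σ σ)) (Sum.inl i) +
        y i • (b.reindex (Equiv.sumCongr σ σ)) (Sum.inr i)) =
        ∑ i, (x (σ i) • b (Sum.inl i) + y (σ i) • b (Sum.inr i)) := by
      rw [← Equiv.sum_comp σ]
      simp
    have hempty : ∀ i : Fin n, ¬ (k ≤ (i : ℕ) ∧ (i : ℕ) < k + 0) := fun i => by omega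
    rw [hsum, hform, Finset.sum_filter, Finset.sum_filter,
      Finset.sum_eq_zero fun i _ => if_neg (hempty i), add_zero,
      ← Equiv.sum_comp σ fun i : Fin n =>
        if (i : ℕ) < k then μ (σ.symm i) * (x i ^ 2 + y i ^ 2) else 0]
    refine Finset.sum_congr rfl fun i _ => ?_
    rw [Equiv.symm_apply_apply]
    by_cases hi : (σ i : ℕ) < k
    · rw [if_pos hi]
    · rw [if_neg hi, le_antisymm (not_lt.mp ((hσ i).not.mp hi)) (hμ i), zero_mul]

/-! ### Commutation and the Poisson bracket -/

/-- Quadratic forms Poisson commute if and only if their Hamilton maps commute. -/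
theorem poissonBracket_eq_zero_iff (hω : IsSymplecticForm ω) {Q R : QuadraticForm ℝ V}
    (hQ : IsPosSemidef Q) (hR : IsPosSemidef R) :
    poissonBracket hω Q R = 0 ↔
      ∀ u, hamiltonMap hω Q (hamiltonMap hω R u) = hamiltonMap hω R (hamiltonMap hω Q u) := by
  have hHQ := isPosHamiltonian_hamiltonMap hω hQ
  have hHR := isPosHamiltonian_hamiltonMap hω hR
  have hbr : ∀ u, poissonBracket hω Q R u =
      4 * ω (hamiltonMap hω Q u) (hamiltonMap hω R u) := fun u =>
    poissonBracketIn_quadraticForm hω (exists_symplecticBasis hω).choose_spec.choose_spec Q R u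
  constructor
  · intro h u
    have h0 : ∀ v, ω (hamiltonMap hω Q v) (hamiltonMap hω R v) = 0 := by
      intro v
      have := hbr v
      rw [h, Pi.zero_apply] at this
      linarith
    refine sub_eq_zero.mp (hω.nondegenerate.2 _ fun v => ?_)
    -- polarization of the vanishing quadratic form in `h0`
    have hpol := h0 (u + v)
    simp only [map_add, LinearMap.add_apply, h0] at hpol
    rw [map_sub]
    linarith [hHQ.apply_left hω v (hamiltonMap hω R u),
      hω.skew (hamiltonMap hω Q u) (hamiltonMap hω R v),
      hHR.apply_left hω v (hamiltonMap hω Q u)]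
  · intro h
    funext u
    have h1 := hHR.apply_left hω u (hamiltonMap hω Q u)
    rw [← h, ← hHQ.apply_left hω] at h1
    rw [hbr, Pi.zero_apply]
    linarith [hω.skew (hamiltonMap hω Q u) (hamiltonMap hω R u)]

/-- The simultaneous normal form for a family, which may be empty. -/
theorem exists_common_normalForm_iff (hω : IsSymplecticForm ω) {n : ℕ}
    (hn : finrank ℝ V = 2 * n) (F : Set (QuadraticForm ℝ V))
    (hF : ∀ Q ∈ F, IsPosSemidef Q ∧ IsSymplecticSubspace ω (LinearMap.ker (hamiltonMap hω Q))) :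
    (∃ b : Basis (Fin n ⊕ Fin n) ℝ V, IsSymplecticBasis ω b ∧
        ∀ Q ∈ F, ReducesToNormalForm b Q) ↔
      (IsSymplecticSubspace ω (⨅ Q ∈ F, LinearMap.ker (hamiltonMap hω Q)) ∧
        ∀ Q ∈ F, ∀ R ∈ F, poissonBracket hω Q R = 0) := by
  have hinf : (⨅ Q ∈ F, LinearMap.ker (hamiltonMap hω Q)) =
      ⨅ H ∈ hamiltonMap hω '' F, LinearMap.ker H := iInf_image.symm
  rw [hinf]
  constructor
  · rintro ⟨b, hb, hred⟩
    have hdiag : ∀ H ∈ hamiltonMap hω '' F, ∃ μ, IsDiagonalIn b H μ := by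
      rintro _ ⟨Q, hQ, rfl⟩
      exact isDiagonalIn_of_reducesToNormalForm hω hb (hF Q hQ).1 (hF Q hQ).2 (hred Q hQ)
    refine ⟨isSymplecticSubspace_iInf_ker_of_isDiagonalIn hω hb hdiag, fun Q hQ R hR => ?_⟩
    obtain ⟨μ, hμ⟩ := hdiag _ ⟨Q, hQ, rfl⟩
    obtain ⟨ν, hν⟩ := hdiag _ ⟨R, hR, rfl⟩
    exact (poissonBracket_eq_zero_iff hω (hF Q hQ).1 (hF R hR).1).mpr (hμ.comm hν)
  · rintro ⟨hsymp, hbr⟩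
    obtain ⟨b, hb, hdiag⟩ := exists_symplecticBasis_isDiagonalIn hω hn
      (by
        rintro _ ⟨Q, hQ, rfl⟩
        exact isPosHamiltonian_hamiltonMap hω (hF Q hQ).1)
      (by
        rintro _ ⟨Q, hQ, rfl⟩ _ ⟨R, hR, rfl⟩
        exact (poissonBracket_eq_zero_iff hω (hF Q hQ).1 (hF R hR).1).mp (hbr Q hQ R hR))
      hsymp
    refine ⟨b, hb, fun Q hQ => ?_⟩
    obtain ⟨μ, hμ⟩ := hdiag _ ⟨Q, hQ, rfl⟩
    exact reducesToNormalForm_of_isDiagonalIn hω hb (hF Q hQ).1 hμ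

end

end SymplecticNormalForm

theorem mainTheorem1 {V : Type*} [AddCommGroup V] [Module ℝ V] [FiniteDimensional ℝ V]
    (n : ℕ) (hn : Module.finrank ℝ V = 2 * n)
    (ω : LinearMap.BilinForm ℝ V) (hω : SymplecticNormalForm.IsSymplecticForm ω) :
    (∀ Q R : QuadraticForm ℝ V,
      SymplecticNormalForm.IsPosSemidef Q → SymplecticNormalForm.IsPosSemidef R →
      SymplecticNormalForm.IsSymplecticSubspace ω
        (LinearMap.ker (SymplecticNormalForm.hamiltonMap hω Q)) →
      SymplecticNormalForm.IsSymplecticSubspace ω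
        (LinearMap.ker (SymplecticNormalForm.hamiltonMap hω R)) →
      ((∃ b : Module.Basis (Fin n ⊕ Fin n) ℝ V, SymplecticNormalForm.IsSymplecticBasis ω b ∧
          SymplecticNormalForm.ReducesToNormalForm b Q ∧
          SymplecticNormalForm.ReducesToNormalForm b R) ↔
        (SymplecticNormalForm.IsSymplecticSubspace ω
            (LinearMap.ker (SymplecticNormalForm.hamiltonMap hω Q) ⊓
              LinearMap.ker (SymplecticNormalForm.hamiltonMap hω R)) ∧
          SymplecticNormalForm.poissonBracket hω Q R = 0))) ∧
    (∀ F : Set (QuadraticForm ℝ V), F.Nonempty →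
      (∀ Q ∈ F, SymplecticNormalForm.IsPosSemidef Q ∧
        SymplecticNormalForm.IsSymplecticSubspace ω
          (LinearMap.ker (SymplecticNormalForm.hamiltonMap hω Q))) →
      ((∃ b : Module.Basis (Fin n ⊕ Fin n) ℝ V, SymplecticNormalForm.IsSymplecticBasis ω b ∧
          ∀ Q ∈ F, SymplecticNormalForm.ReducesToNormalForm b Q) ↔
        (SymplecticNormalForm.IsSymplecticSubspace ω
            (⨅ Q ∈ F, LinearMap.ker (SymplecticNormalForm.hamiltonMap hω Q)) ∧
          ∀ Q ∈ F, ∀ R ∈ F, SymplecticNormalForm.poissonBracket hω Q R = 0))) := by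
  refine ⟨fun Q R hQ hR hkQ hkR => ?_, fun F _ hF =>
    SymplecticNormalForm.exists_common_normalForm_iff hω hn F hF⟩
  have hpair := SymplecticNormalForm.exists_common_normalForm_iff hω hn {Q, R} (by
    rintro S (rfl | rfl)
    exacts [⟨hQ, hkQ⟩, ⟨hR, hkR⟩])
  have hself := fun S (hS : SymplecticNormalForm.IsPosSemidef S) =>
    (SymplecticNormalForm.poissonBracket_eq_zero_iff hω hS hS).mpr fun _ => rfl
  have hflip : SymplecticNormalForm.poissonBracket hω Q R = 0 →
      SymplecticNormalForm.poissonBracket hω R Q = 0 := fun h =>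
    (SymplecticNormalForm.poissonBracket_eq_zero_iff hω hR hQ).mpr fun u =>
      ((SymplecticNormalForm.poissonBracket_eq_zero_iff hω hQ hR).mp h u).symm
  rw [iInf_insert, iInf_singleton] at hpair
  simp only [Set.mem_insert_iff, Set.mem_singleton_iff, forall_eq_or_imp, forall_eq, hself Q hQ, hself R hR, true_and, and_true] at hpair
  rw [hpair]
  exact and_congr_right fun _ => ⟨fun h => h.1, fun h => ⟨h, hflip h⟩⟩
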